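/- Let $D=(V,A)$ be a finite digraph, with finite vertex set $V$ and finite arc multiset $A$ (loops and multiple arcs allowed). Let $B_D(q,y,z)\in\mathbb{Q}[q,y,z]$ be its $B$-polynomial, that is, the unique polynomial such that for every positive integer $q$, $$B_D(q,y,z)=\sum_{f:V\to\{1,\dots,q\}} y^{\#\{(u,v)\in A\,:\,f(v)>f(u)\}}\,z^{\#\{(u,v)\in A\,:\,f(v)<f(u)\}}.$$ (1) If $D$ is acyclic (it has no directed cycle; in particular, no loop), then $$B_D(-q,y,1)=(-1)^{|V|}\,y^{|A|}\,B_D\!\left(q,\frac1y,1\right).$$ (2) If the underlying multigraph of $D$ (obtained by replacing each arc $(u,v)$ by an edge $\{u,v\}$, keeping multiplicities) is a forest, i.e. has no cycles (in particular, no loops and no multiple edges), then $$B_D(-q,y,z)=(-1)^{|V|}\,(y+z-1)^{|A|}\,B_D\!\left(q,\frac{y}{y+z-1},\frac{z}{y+z-1}\right).$$ Both are identities of rational functions in $q,y,z$; equivalently, they hold for all $q,y,z$ in any field of characteristic zero, with $y\neq0$ in (1) and $y+z-1\neq0$ in (2). -/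

import Mathlib

/-- A digraph with vertex set `V` and arc set `A`. Arcs have their own identity, so loops and
multiple arcs are allowed. Finiteness of `V` and `A` is imposed where it is needed. -/
structure MultiDigraph (V A : Type*) where
  /-- The origin of an arc. -/
  origin : A → V
  /-- The target of an arc. -/
  target : A → V

namespace MultiDigraph

variable {V A : Type*}

/-- `D` is acyclic: it has no directed cycle, i.e. no vertex can be reached from itself by a
directed path with at least one arc (in particular, there are no loops). -/
def IsAcyclic (D : MultiDigraph V A) : Prop :=
  ∀ v : V, ¬ Relation.TransGen (fun u w => ∃ a, D.origin a = u ∧ D.target a = w) v v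

/-- The edge of the underlying multigraph that comes from the arc `a`. -/
def edge (D : MultiDigraph V A) (a : A) : Sym2 V :=
  s(D.origin a, D.target a)

/-- The underlying multigraph of `D` is a forest, i.e. has no cycle: there are no loops (cycles of
length one), no two distinct arcs with the same pair of endpoints (cycles of length two), and the
simple graph formed by the edges has no cycles (of length at least three). -/
structure UnderlyingIsForest (D : MultiDigraph V A) : Prop where
  no_loop : ∀ a, D.origin a ≠ D.target a
  no_parallel : Function.Injective D.edge
  no_cycle : (SimpleGraph.fromEdgeSet (Set.range D.edge)).IsAcyclic

/-- The number of ascents of a coloring `f`: arcs `(u, v)` with `f v > f u`. -/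
def numAscents [Fintype A] (D : MultiDigraph V A) {q : ℕ} (f : V → Fin q) : ℕ :=
  (Finset.univ.filter fun a => f (D.origin a) < f (D.target a)).card

/-- The number of descents of a coloring `f`: arcs `(u, v)` with `f v < f u`. -/
def numDescents [Fintype A] (D : MultiDigraph V A) {q : ℕ} (f : V → Fin q) : ℕ :=
  (Finset.univ.filter fun a => f (D.target a) < f (D.origin a)).card

/-- The defining property of the `B`-polynomial in the variables `q = X 0`, `y = X 1`, `z = X 2`:
substituting any positive integer for the first variable gives the generating polynomial of
colorings with `q` colors, counted by ascents and descents. -/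
def IsBPolynomial [Fintype V] [DecidableEq V] [Fintype A] (D : MultiDigraph V A)
    (P : MvPolynomial (Fin 3) ℚ) : Prop :=
  ∀ q : ℕ, 0 < q →
    MvPolynomial.bind₁ ![(q : MvPolynomial (Fin 3) ℚ), MvPolynomial.X 1, MvPolynomial.X 2] P =
      ∑ f : V → Fin q,
        MvPolynomial.X 1 ^ D.numAscents f * MvPolynomial.X 2 ^ D.numDescents f

theorem sum_colorings_eq [Fintype V] [DecidableEq V] [Fintype A] (D : MultiDigraph V A)
    {R : Type*} [CommRing R] (y z : R) (q : ℕ) :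
    ∑ f : V → Fin q, y ^ D.numAscents f * z ^ D.numDescents f =
      ∑ p ∈ Finset.range (Fintype.card V + 1), q.choose p •
        ∑ g : V → Fin p with Function.Surjective g,
          y ^ D.numAscents g * z ^ D.numDescents g := by
  classical
  set W : ℕ → R := fun p => ∑ g : V → Fin p with Function.Surjective g,
          y ^ D.numAscents g * z ^ D.numDescents g with hW
  have hW0 : ∀ p, Fintype.card V < p → W p = 0 := by
    intro p hp
    simp only [hW]
    apply Finset.sum_eq_zero
    intro g hg
    have := Fintype.card_le_of_surjective g (Finset.mem_filter.1 hg).2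
    simp at this
    omega
  have h1 : ∀ s : Finset (Fin q),
      ∑ f : V → Fin q with Finset.univ.image f = s,
        y ^ D.numAscents f * z ^ D.numDescents f = W s.card := by
    intro s
    symm
    simp only [hW]
    refine Finset.sum_bij (fun g _ => fun v => s.orderEmbOfFin rfl (g v)) ?_ ?_ ?_ ?_
    · intro g hg
      have hg := (Finset.mem_filter.1 hg).2
      simp only [Finset.mem_filter, Finset.mem_univ, true_and]
      ext c
      simp only [Finset.mem_image, Finset.mem_univ, true_and]
      constructor
      · rintro ⟨v, rfl⟩
        exact Finset.orderEmbOfFin_mem _ _ _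
      · intro hc
        have : c ∈ Set.range (s.orderEmbOfFin rfl) := by
          rw [Finset.range_orderEmbOfFin]; exact hc
        obtain ⟨i, rfl⟩ := this
        obtain ⟨v, rfl⟩ := hg i
        exact ⟨v, rfl⟩
    · intro g _ g' _ h
      funext v
      exact (s.orderEmbOfFin rfl).injective (congrFun h v)
    · intro f hf
      have hf := (Finset.mem_filter.1 hf).2
      have hmem : ∀ v, f v ∈ Set.range (s.orderEmbOfFin rfl) := by
        intro v
        rw [Finset.range_orderEmbOfFin, ← hf]
        simp
      choose g hg using hmem
      refine ⟨g, ?_, funext hg⟩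
      simp only [Finset.mem_filter, Finset.mem_univ, true_and]
      intro i
      have : s.orderEmbOfFin rfl i ∈ Finset.univ.image f := by
        rw [hf]; exact Finset.orderEmbOfFin_mem _ _ _
      obtain ⟨v, -, hv⟩ := Finset.mem_image.1 this
      exact ⟨v, (s.orderEmbOfFin rfl).injective (by rw [hg, hv])⟩
    · intro g _
      simp [numAscents, numDescents]
  calc ∑ f : V → Fin q, y ^ D.numAscents f * z ^ D.numDescents f
      = ∑ s : Finset (Fin q), W s.card := by
        rw [← Finset.sum_fiberwise (g := fun f : V → Fin q => Finset.univ.image f)]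
        exact Finset.sum_congr rfl fun s _ => h1 s
    _ = ∑ p ∈ Finset.range (q + 1), q.choose p • W p := by
        have := Finset.sum_powerset_apply_card W (x := (Finset.univ : Finset (Fin q)))
        simpa using this
    _ = ∑ p ∈ Finset.range (max q (Fintype.card V) + 1), q.choose p • W p := by
        apply Finset.sum_subset
        · intro p; simp only [Finset.mem_range]; omega
        · intro p _ hp
          rw [Nat.choose_eq_zero_of_lt (by simpa using hp), zero_smul]
    _ = ∑ p ∈ Finset.range (Fintype.card V + 1), q.choose p • W p := by
        symm
        apply Finset.sum_subset
        · intro p; simp only [Finset.mem_range]; omega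
        · intro p _ hp
          rw [hW0 p (by simpa using hp), smul_zero]

/-- There is exactly one polynomial with the defining property of the `B`-polynomial. -/
theorem existsUnique_isBPolynomial [Fintype V] [DecidableEq V] [Fintype A]
    (D : MultiDigraph V A) : ∃! P, D.IsBPolynomial P := by
  classical
  refine existsUnique_of_exists_of_unique ⟨∑ p ∈ Finset.range (Fintype.card V + 1),
    MvPolynomial.C ((p.factorial : ℚ)⁻¹) *
      (∏ i ∈ Finset.range p, (MvPolynomial.X 0 - (i : MvPolynomial (Fin 3) ℚ))) *
      ∑ g : V → Fin p with Function.Surjective g,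
        MvPolynomial.X 1 ^ D.numAscents g * MvPolynomial.X 2 ^ D.numDescents g, ?_⟩ ?_
  · intro q _
    rw [sum_colorings_eq]
    simp only [map_sum, map_mul, map_pow, map_prod, map_sub, map_natCast,
      MvPolynomial.bind₁_X_right, MvPolynomial.bind₁_C_right]
    refine Finset.sum_congr rfl fun p _ => ?_
    have key : MvPolynomial.C ((p.factorial : ℚ)⁻¹) *
        (∏ i ∈ Finset.range p, ((q : MvPolynomial (Fin 3) ℚ) - (i : MvPolynomial (Fin 3) ℚ)))
          = (q.choose p : MvPolynomial (Fin 3) ℚ) := by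
      have h2 : (∏ i ∈ Finset.range p, ((q : ℚ) - (i : ℚ))) = p.factorial * q.choose p := by
        rw [← Nat.cast_mul, ← Nat.descFactorial_eq_factorial_mul_choose,
          Nat.descFactorial_eq_prod_range, Nat.cast_prod]
        by_cases hpq : p ≤ q
        · refine Finset.prod_congr rfl fun i hi => ?_
          rw [Nat.cast_sub (by have := Finset.mem_range.1 hi; omega)]
        · rw [Finset.prod_eq_zero (Finset.mem_range.2 (not_le.1 hpq)) (sub_self _),
            Finset.prod_eq_zero (Finset.mem_range.2 (not_le.1 hpq)) (by simp)]
      have h3 := congrArg (MvPolynomial.C (σ := Fin 3)) h2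
      simp only [map_prod, map_sub, map_natCast, map_mul] at h3
      rw [h3, ← mul_assoc, ← map_natCast (MvPolynomial.C (σ := Fin 3) (R := ℚ)) p.factorial,
        ← map_mul, inv_mul_cancel₀ (by exact_mod_cast p.factorial_ne_zero), map_one, one_mul]
    rw [nsmul_eq_mul, ← key]
    simp
  · intro P Q hP hQ
    refine MvPolynomial.funext_set
      ![Set.range (fun n : ℕ => ((n + 1 : ℕ) : ℚ)), Set.univ, Set.univ] ?_ ?_
    · intro i
      fin_cases i
      · exact Set.infinite_range_of_injective fun a b h => by simpa using h
      · exact Set.infinite_univ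
      · exact Set.infinite_univ
    · intro x hx
      obtain ⟨n, hn⟩ : x 0 ∈ Set.range (fun n : ℕ => ((n + 1 : ℕ) : ℚ)) := hx 0 (Set.mem_univ _)
      have h := congrArg (MvPolynomial.eval x)
        ((hP (n + 1) n.succ_pos).trans (hQ (n + 1) n.succ_pos).symm)
      have e : ∀ R : MvPolynomial (Fin 3) ℚ, MvPolynomial.eval x (MvPolynomial.bind₁
          ![((n + 1 : ℕ) : MvPolynomial (Fin 3) ℚ), MvPolynomial.X 1, MvPolynomial.X 2] R) =
          MvPolynomial.eval x R := by
        intro R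
        change MvPolynomial.aeval x (MvPolynomial.bind₁ _ R) = MvPolynomial.aeval x R
        rw [MvPolynomial.aeval_bind₁]
        congr 2
        funext i
        fin_cases i
        · simpa using hn
        · simp
        · simp
      rwa [e, e] at h

/-- The `B`-polynomial of `D`, in the variables `q = X 0`, `y = X 1`, `z = X 2`. -/
noncomputable def bPoly [Fintype V] [DecidableEq V] [Fintype A] (D : MultiDigraph V A) :
    MvPolynomial (Fin 3) ℚ :=
  D.existsUnique_isBPolynomial.choose

theorem bPoly_spec [Fintype V] [DecidableEq V] [Fintype A] (D : MultiDigraph V A) :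
    D.IsBPolynomial D.bPoly :=
  D.existsUnique_isBPolynomial.choose_spec.1

/-- The value `B_D(q, y, z)` at elements `q`, `y`, `z` of a field of characteristic zero. -/
noncomputable def B [Fintype V] [DecidableEq V] [Fintype A] (D : MultiDigraph V A)
    {K : Type*} [Field K] [CharZero K] (q y z : K) : K :=
  MvPolynomial.aeval ![q, y, z] D.bPoly

end MultiDigraph

/-! Give each ascent weight `y`, each descent `z` and each tie `1`: an arc contributes 1 +
(y-1)[ascent] + (z-1)[descent]. Expanding the product over arcs writes the sum over colorings as a
combination, over all `s : A → Fin 3` (drop, keep or reverse each arc), of counts of strictly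
order-preserving maps. If the strict inequalities become weak, the same coefficients give a tie the
weight 1 + (y-1) + (z-1) = y+z-1. So order-polynomial reciprocity (strict at -q is, up to sign, weak
at q), applied to each `s` with nonzero coefficient, gives `B_neg_natCast`, and dividing all weights
by y+z-1 gives the theorem. This needs each such orientation to be acyclic: in a forest all are, and
for z = 1 only subdigraphs of `D` survive.

Order reciprocity (`exists_orderPolynomial`) comes from linear algebra on functions of subsets of V.
A coloring is a chain of sublevel sets, so counts with q colors are entries of the q-th power of a
transfer operator. The strict operator L is unitriangular, so the entries of L^q are polynomial in
q, and its inverse is the signed weak operator. -/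

open Finset Polynomial

/-! ### Reciprocity for order polynomials through transfer operators -/

section OrderReciprocity

variable {V K : Type*} [Fintype V] [DecidableEq V] [Field K]

/-- The operator `(L v)(S) = ∑_{T ⊆ S} w(S, T) v(T)` on functions of subsets of `V`. -/
def transfer (w : Finset V → Finset V → K) : Module.End K (Finset V → K) where
  toFun v S := ∑ T ∈ S.powerset, w S T * v T
  map_add' u v := by
    funext S
    simp [mul_add, sum_add_distrib]
  map_smul' c v := by
    funext S
    simp only [Pi.smul_apply, smul_eq_mul, RingHom.id_apply, mul_sum]
    exact sum_congr rfl fun T _ => by ring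

omit [Fintype V] [DecidableEq V] in
theorem transfer_apply (w : Finset V → Finset V → K) (v : Finset V → K) (S : Finset V) :
    transfer w v S = ∑ T ∈ S.powerset, w S T * v T := rfl

/-- The maps `V → ℕ` that color `S` by `0, …, q - 1` and take the value `q` off `S`. -/
def partialColorings (q : ℕ) (S : Finset V) : Finset (V → ℕ) :=
  Fintype.piFinset fun v => if v ∈ S then range q else {q}

theorem mem_partialColorings {q : ℕ} {S : Finset V} {f : V → ℕ} :
    f ∈ partialColorings q S ↔ ∀ v, (v ∈ S → f v < q) ∧ (v ∉ S → f v = q) := by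
  simp only [partialColorings, Fintype.mem_piFinset]
  refine forall_congr' fun v => ?_
  by_cases h : v ∈ S <;> simp [h]

/-- The product of the weights along the chain of sublevel sets of `f`. -/
def chainWeight (w : Finset V → Finset V → K) (q : ℕ) (f : V → ℕ) : K :=
  ∏ i ∈ range q, w {v | f v ≤ i} {v | f v < i}

/-- Each application of the operator adds a top color class `S \ T` to a coloring of `T`. -/
theorem transfer_pow_apply (w : Finset V → Finset V → K) (q : ℕ) (S : Finset V) :
    (transfer w ^ q) (Pi.single ∅ 1) S = ∑ f ∈ partialColorings q S, chainWeight w q f := by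
  induction q generalizing S with
  | zero =>
    simp only [pow_zero, Module.End.one_apply, chainWeight, range_zero, prod_empty, sum_const,
      nsmul_eq_mul, mul_one]
    by_cases h : S = ∅
    · subst h
      simp [partialColorings]
    · obtain ⟨v, hv⟩ := nonempty_iff_ne_empty.2 h
      rw [Pi.single_eq_of_ne h, eq_comm]
      have : partialColorings 0 S = ∅ := by
        refine eq_empty_of_forall_notMem fun f hf => ?_
        exact absurd ((mem_partialColorings.1 hf v).1 hv) (Nat.not_lt_zero _)
      simp [this]
  | succ q ih =>
    rw [pow_succ', Module.End.mul_apply, transfer_apply]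
    simp only [ih, mul_sum]
    rw [← sum_fiberwise_of_maps_to (s := partialColorings (q + 1) S) (t := S.powerset)
      (g := fun f => ({v | f v < q} : Finset V))]
    · refine sum_congr rfl fun T hT => ?_
      have hTS := mem_powerset.1 hT
      -- A coloring of `T` already has value `q` on `S \ T`, so only the value off `S` has to rise
      -- to `q + 1`; truncation at `q` undoes this.
      refine sum_bij' (fun f _ v => if v ∈ S then f v else q + 1) (fun f _ v => min (f v) q)
        ?_ ?_ ?_ ?_ ?_
      · intro f hf
        rw [mem_partialColorings] at hf
        rw [mem_filter, mem_partialColorings]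
        refine ⟨fun v => ⟨fun hv => ?_, fun hv => if_neg hv⟩, ?_⟩
        · by_cases h : v ∈ T
          · have := (hf v).1 h
            simp only [hv, if_true]; omega
          · have := (hf v).2 h
            simp only [hv, if_true]; omega
        · ext v
          have h1 := hf v
          have h2 := @hTS v
          by_cases h : v ∈ T
          · simp [h, h2 h, h1.1 h]
          · by_cases h' : v ∈ S <;> simp [h, h', h1.2 h]
      · intro f hf
        rw [mem_filter, mem_partialColorings] at hf
        rw [mem_partialColorings]
        intro v
        have h1 := hf.1 v
        have h2 : v ∈ T ↔ f v < q := by rw [← hf.2]; simp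
        rw [h2]
        omega
      · intro f hf
        rw [mem_partialColorings] at hf
        funext v
        have h1 := hf v
        have h2 := @hTS v
        by_cases h : v ∈ S
        · by_cases h' : v ∈ T
          · have := h1.1 h'
            simp only [h, if_true]; omega
          · have := h1.2 h'
            simp only [h, if_true]; omega
        · have := h1.2 fun h' => h (h2 h')
          simp only [h, if_false]; omega
      · intro f hf
        rw [mem_filter, mem_partialColorings] at hf
        funext v
        have h1 := hf.1 v
        have h2 : v ∈ T ↔ f v < q := by rw [← hf.2]; simp
        by_cases h : v ∈ S
        · have := h1.1 h
          simp only [h, if_true]; omega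
        · have := h1.2 h
          simp only [h, if_false]; omega
      · intro f hf
        rw [mem_partialColorings] at hf
        -- The new factor, at `i = q`, is `w S T`; the earlier sublevel sets do not change.
        rw [chainWeight, chainWeight, prod_range_succ, mul_comm]
        congr 1
        · refine prod_congr rfl fun i hi => ?_
          have hi := mem_range.1 hi
          congr 1 <;> ext v
          all_goals
            simp only [mem_filter, mem_univ, true_and]
            by_cases h : v ∈ S
            · simp [h]
            · have := (hf v).2 fun h' => h (hTS h')
              simp only [h, if_false]; omega
        · congr 1 <;> ext v
          all_goals
            simp only [mem_filter, mem_univ, true_and]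
            have h1 := hf v
            have h2 := @hTS v
            by_cases h : v ∈ S
            · by_cases h' : v ∈ T
              · have := h1.1 h'
                simp only [h, h', if_true, true_iff]; omega
              · have := h1.2 h'
                simp only [h, h', if_true, true_iff, false_iff]; omega
            · have h' : v ∉ T := fun h' => h (h2 h')
              simp only [h, h', if_false, false_iff]; omega
    · intro f hf
      rw [mem_partialColorings] at hf
      rw [mem_powerset]
      intro v hv
      by_contra h
      have := (hf v).2 h
      simp only [mem_filter, mem_univ, true_and] at hv
      omega

theorem transfer_pow_apply_univ (w : Finset V → Finset V → K) (q : ℕ) :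
    (transfer w ^ q) (Pi.single ∅ 1) univ =
      ∑ f : V → Fin q, chainWeight w q fun v => (f v : ℕ) := by
  rw [transfer_pow_apply]
  symm
  refine sum_bij (fun f _ v => (f v : ℕ)) ?_ ?_ ?_ ?_
  · intro f _
    simp [mem_partialColorings]
  · intro f _ g _ h
    funext v
    exact Fin.ext (congrFun h v)
  · intro f hf
    rw [mem_partialColorings] at hf
    exact ⟨fun v => ⟨f v, (hf v).1 (mem_univ v)⟩, mem_univ _, rfl⟩
  · intro f _
    rfl

open Classical in
/-- `1` if no arc of `r` leads from `S \ T` into `S`, and `0` otherwise. -/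
noncomputable def strictWeight (K : Type*) [Field K] (r : V → V → Prop) (S T : Finset V) : K :=
  if ∀ u ∈ S \ T, ∀ v ∈ S, ¬ r u v then 1 else 0

open Classical in
/-- `(-1) ^ #(S \ T)` if no arc of `r` leads from `S \ T` into `T`, and `0` otherwise. -/
noncomputable def weakWeight (K : Type*) [Field K] (r : V → V → Prop) (S T : Finset V) : K :=
  (-1) ^ (S \ T).card * if ∀ u ∈ S \ T, ∀ v ∈ T, ¬ r u v then 1 else 0

open Classical in
theorem chainWeight_strictWeight (r : V → V → Prop) {q : ℕ} (f : V → Fin q) :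
    chainWeight (strictWeight K r) q (fun v => (f v : ℕ)) =
      if ∀ u v, r u v → f u < f v then 1 else 0 := by
  simp only [chainWeight, strictWeight]
  rw [prod_boole]
  congr 1
  simp only [mem_range, mem_sdiff, mem_filter, mem_univ, true_and, eq_iff_iff]
  constructor
  · intro h u v hr
    by_contra hlt
    exact h (f u) (f u).2 u ⟨le_rfl, lt_irrefl _⟩ v (by simpa using hlt) hr
  · intro h i _ u hu v hv hr
    have : (f u : ℕ) < f v := h u v hr
    omega

open Classical in
theorem chainWeight_weakWeight (r : V → V → Prop) {q : ℕ} (f : V → Fin q) :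
    chainWeight (weakWeight K r) q (fun v => (f v : ℕ)) =
      (-1) ^ Fintype.card V * if ∀ u v, r u v → f u ≤ f v then 1 else 0 := by
  simp only [chainWeight, weakWeight]
  rw [prod_mul_distrib, prod_boole, prod_pow_eq_pow_sum]
  congr 2
  · have h := card_eq_sum_card_fiberwise (s := (univ : Finset V)) (t := range q)
      (f := fun v => (f v : ℕ)) fun v _ => by simp
    rw [card_univ] at h
    rw [h]
    refine sum_congr rfl fun i _ => congrArg card ?_
    ext v
    simp only [mem_sdiff, mem_filter, mem_univ, true_and]
    omega
  · simp only [mem_range, mem_sdiff, mem_filter, mem_univ, true_and, eq_iff_iff]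
    constructor
    · intro h u v hr
      by_contra hle
      exact h (f u) (f u).2 u ⟨le_rfl, lt_irrefl _⟩ v (by simpa using hle) hr
    · intro h i _ u hu v hv hr
      have : (f u : ℕ) ≤ f v := h u v hr
      omega

omit [DecidableEq V] in
/-- A nonempty finite set has a sink with respect to an acyclic relation. -/
theorem exists_sink {r : V → V → Prop} (hr : ∀ v, ¬ Relation.TransGen r v v) {S : Finset V}
    (hS : S.Nonempty) : ∃ x ∈ S, ∀ v ∈ S, ¬ r x v := by
  have : IsStrictOrder V (Function.swap (Relation.TransGen r)) :=
    { irrefl := hr, trans := fun a b c h1 h2 => h2.trans h1 }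
  have wf : WellFounded (Function.swap (Relation.TransGen r)) :=
    Finite.wellFounded_of_trans_of_irrefl _
  obtain ⟨x, hx, h⟩ := wf.has_min (S : Set V) hS
  exact ⟨x, hx, fun v hv hxv => h v hv (Relation.TransGen.single hxv)⟩

/-- For `R ≠ S`, either every term vanishes or toggling a sink of `S \ R` in and out of `T` is a
sign-reversing involution. Acyclicity provides the sink. -/
theorem sum_strictWeight_mul_weakWeight {r : V → V → Prop}
    (hr : ∀ v, ¬ Relation.TransGen r v v) {R S : Finset V} (hRS : R ⊆ S) :
    ∑ T ∈ Icc R S, strictWeight K r S T * weakWeight K r T R = if R = S then 1 else 0 := by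
  classical
  split_ifs with h
  · subst h
    rw [Icc_self, sum_singleton, strictWeight, weakWeight, sdiff_self]
    simp
  -- An arc from `u ∈ S \ R` into `R` kills the weak factor if `u ∈ T` and the strict factor if `u ∉
  -- T`.
  by_cases hcut : ∃ u ∈ S \ R, ∃ v ∈ R, r u v
  · obtain ⟨u, hu, v, hv, huv⟩ := hcut
    rw [mem_sdiff] at hu
    refine sum_eq_zero fun T hT => ?_
    by_cases huT : u ∈ T
    · have : ¬ ∀ u ∈ T \ R, ∀ v ∈ R, ¬ r u v := fun h =>
        h u (mem_sdiff.2 ⟨huT, hu.2⟩) v hv huv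
      rw [weakWeight, if_neg this, mul_zero, mul_zero]
    · have : ¬ ∀ u ∈ S \ T, ∀ v ∈ S, ¬ r u v := fun h =>
        h u (mem_sdiff.2 ⟨hu.1, huT⟩) v (hRS hv) huv
      rw [strictWeight, if_neg this, zero_mul]
  · push Not at hcut
    obtain ⟨x, hx, hsink⟩ := exists_sink hr (S := S \ R)
      (sdiff_nonempty.2 fun h' => h (hRS.antisymm h'))
    have hxS : ∀ v ∈ S, ¬ r x v := fun v hv => by
      by_cases hvR : v ∈ R
      · exact hcut x hx v hvR
      · exact hsink v (mem_sdiff.2 ⟨hv, hvR⟩)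
    rw [mem_sdiff] at hx
    have hweak : ∀ T ∈ Icc R S, weakWeight K r T R = (-1) ^ (T \ R).card := fun T hT => by
      rw [mem_Icc] at hT
      rw [weakWeight, if_pos, mul_one]
      intro u hu v hv
      rw [mem_sdiff] at hu
      exact hcut u (mem_sdiff.2 ⟨hT.2 hu.1, hu.2⟩) v hv
    have key : ∀ T ∈ Icc R S, x ∉ T →
        strictWeight K r S T * weakWeight K r T R +
          strictWeight K r S (insert x T) * weakWeight K r (insert x T) R = 0 := by
      intro T hT hxT
      have hT' : insert x T ∈ Icc R S := by
        rw [mem_Icc] at hT ⊢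
        exact ⟨hT.1.trans (subset_insert x T), insert_subset hx.1 hT.2⟩
      -- No arc leads from `x` into `S`, so `x` imposes no condition on the strict weight.
      have hstrict : strictWeight K r S (insert x T) = strictWeight K r S T := by
        unfold strictWeight
        congr 1
        rw [eq_iff_iff]
        constructor
        · intro h u hu v hv
          rw [mem_sdiff] at hu
          by_cases hux : u = x
          · exact hux ▸ hxS v hv
          · exact h u (by simp [hu, hux]) v hv
        · intro h u hu v hv
          refine h u ?_ v hv
          simp only [mem_sdiff, mem_insert, not_or] at hu ⊢
          exact ⟨hu.1, hu.2.2⟩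
      rw [hweak T hT, hweak _ hT', hstrict, insert_sdiff_of_notMem _ hx.2,
        card_insert_of_notMem (by simp [hxT]), pow_succ]
      ring
    rw [← sum_filter_add_sum_filter_not (Icc R S) (fun T => x ∉ T)]
    have : ∑ T ∈ Icc R S with ¬ x ∉ T, strictWeight K r S T * weakWeight K r T R =
        ∑ T ∈ Icc R S with x ∉ T,
          strictWeight K r S (insert x T) * weakWeight K r (insert x T) R := by
      symm
      refine sum_bij' (fun T _ => insert x T) (fun T _ => T.erase x) ?_ ?_ ?_ ?_ ?_
      · intro T hT
        simp only [mem_filter, mem_Icc, mem_insert, true_or, not_true, not_false_iff,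
          and_true] at hT ⊢
        exact ⟨hT.1.1.trans (subset_insert x T), insert_subset hx.1 hT.1.2⟩
      · intro T hT
        simp only [mem_filter, mem_Icc, not_not] at hT ⊢
        exact ⟨⟨fun a ha => mem_erase.2 ⟨fun e => hx.2 (e ▸ ha), hT.1.1 ha⟩,
          (erase_subset x T).trans hT.1.2⟩, notMem_erase x T⟩
      · intro T hT
        exact erase_insert (mem_filter.1 hT).2
      · intro T hT
        exact insert_erase (not_not.1 (mem_filter.1 hT).2)
      · intro T _
        rfl
    rw [this, ← sum_add_distrib]
    exact sum_eq_zero fun T hT => key T (mem_filter.1 hT).1 (mem_filter.1 hT).2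

theorem transfer_strictWeight_mul_weakWeight {r : V → V → Prop}
    (hr : ∀ v, ¬ Relation.TransGen r v v) :
    transfer (strictWeight K r) * transfer (weakWeight K r) = 1 := by
  refine LinearMap.ext fun v => funext fun S => ?_
  rw [Module.End.mul_apply, transfer_apply, Module.End.one_apply]
  simp only [transfer_apply, mul_sum]
  rw [sum_comm' (t' := S.powerset) (s' := fun R => Icc R S)]
  · rw [sum_eq_single_of_mem S (mem_powerset_self S)]
    · simp only [← mul_assoc, ← sum_mul]
      rw [sum_strictWeight_mul_weakWeight hr subset_rfl, if_pos rfl, one_mul]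
    · intro R hR hne
      simp only [← mul_assoc, ← sum_mul]
      rw [sum_strictWeight_mul_weakWeight hr (mem_powerset.1 hR), if_neg hne, zero_mul]
  · intro T R
    simp only [mem_powerset, mem_Icc]
    exact ⟨fun h => ⟨⟨h.2, h.1⟩, h.2.trans h.1⟩, fun h => ⟨h.1.2, h.1.1⟩⟩

-- Without its diagonal the operator only looks at proper subsets, so `k` applications need a strict
-- chain of length `k` below `S`.
omit [Fintype V] in
theorem transfer_sub_one_pow_apply (w : Finset V → Finset V → K) (hw : ∀ S, w S S = 1)
    (k : ℕ) (v : Finset V → K) (S : Finset V) (hS : S.card < k) :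
    ((transfer w - 1) ^ k) v S = 0 := by
  induction k generalizing S with
  | zero => omega
  | succ k ih =>
    rw [pow_succ', Module.End.mul_apply, LinearMap.sub_apply, Pi.sub_apply, transfer_apply,
      Module.End.one_apply, ← add_sum_erase _ _ (mem_powerset_self S), hw, one_mul,
      add_sub_cancel_left]
    refine sum_eq_zero fun T hT => ?_
    rw [mem_erase, mem_powerset] at hT
    have := card_lt_card (hT.2.ssubset_of_ne hT.1)
    rw [ih T (by omega), mul_zero]

-- Expand (1 + (L - 1))^q binomially: nilpotency bounds the number of terms independently of q, and
-- each binomial coefficient is polynomial in q.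
omit [Fintype V] in
theorem exists_polynomial_eval_eq_transfer_pow [CharZero K] (w : Finset V → Finset V → K)
    (hw : ∀ S, w S S = 1) (v : Finset V → K) (S : Finset V) :
    ∃ P : K[X], ∀ q : ℕ, P.eval (q : K) = (transfer w ^ q) v S := by
  refine ⟨∑ k ∈ range (S.card + 1), C (((transfer w - 1) ^ k) v S * (k.factorial : K)⁻¹) *
    descPochhammer K k, fun q => ?_⟩
  have hexp : transfer w ^ q =
      ∑ k ∈ range (q + 1), (q.choose k) • (transfer w - 1) ^ k := by
    conv_lhs => rw [← sub_add_cancel (transfer w) 1]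
    rw [(Commute.one_right _).add_pow]
    simp [nsmul_eq_mul, Nat.cast_comm]
  have hval : (transfer w ^ q) v S =
      ∑ k ∈ range (q + 1), (q.choose k : K) * ((transfer w - 1) ^ k) v S := by
    rw [hexp, LinearMap.sum_apply, Finset.sum_apply]
    refine sum_congr rfl fun k _ => ?_
    rw [LinearMap.smul_apply, Pi.smul_apply, nsmul_eq_mul]
  have hterm : ∀ k, (C (((transfer w - 1) ^ k) v S * (k.factorial : K)⁻¹) *
      descPochhammer K k).eval (q : K) = (q.choose k : K) * ((transfer w - 1) ^ k) v S := by
    intro k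
    rw [eval_mul, eval_C, descPochhammer_eval_eq_descFactorial,
      Nat.descFactorial_eq_factorial_mul_choose, Nat.cast_mul]
    have : (k.factorial : K) ≠ 0 := by exact_mod_cast k.factorial_ne_zero
    field_simp
  rw [hval, eval_finsetSum]
  simp only [hterm]
  trans ∑ k ∈ range (max q S.card + 1), (q.choose k : K) * ((transfer w - 1) ^ k) v S
  · apply sum_subset
    · intro k
      simp only [mem_range]
      omega
    · intro k _ hk
      rw [transfer_sub_one_pow_apply w hw k v S (by simpa using hk), mul_zero]
  · symm
    apply sum_subset
    · intro k
      simp only [mem_range]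
      omega
    · intro k _ hk
      rw [Nat.choose_eq_zero_of_lt (by simpa using hk), Nat.cast_zero, zero_mul]

omit [Fintype V] [DecidableEq V] in
theorem polynomial_eq_of_eval_natCast_eq [CharZero K] {P Q : K[X]} (m : ℕ)
    (h : ∀ q : ℕ, m ≤ q → P.eval (q : K) = Q.eval (q : K)) : P = Q := by
  refine eq_of_infinite_eval_eq P Q ?_
  refine Set.Infinite.mono (s := Set.range fun n : ℕ => ((m + n : ℕ) : K)) ?_ ?_
  · rintro _ ⟨n, rfl⟩
    exact h _ (by omega)
  · exact Set.infinite_range_of_injective fun a b hab => by simpa using hab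

open Classical in
/-- Reciprocity for order polynomials: the polynomial that counts the strict order-preserving maps
to a chain counts, up to sign, the weak ones at negative integers. -/
theorem exists_orderPolynomial [CharZero K] {r : V → V → Prop}
    (hr : ∀ v, ¬ Relation.TransGen r v v) :
    ∃ P : K[X], ∀ q : ℕ,
      P.eval (q : K) = (∑ f : V → Fin q, if ∀ u v, r u v → f u < f v then 1 else 0) ∧
      P.eval (-(q : K)) = (-1) ^ Fintype.card V *
        ∑ f : V → Fin q, if ∀ u v, r u v → f u ≤ f v then 1 else 0 := by
  have hw : ∀ S, strictWeight K r S S = 1 := fun S => by simp [strictWeight]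
  obtain ⟨P, hP⟩ := exists_polynomial_eval_eq_transfer_pow (strictWeight K r) hw
    (Pi.single ∅ 1) univ
  refine ⟨P, fun q => ⟨?_, ?_⟩⟩
  · rw [hP, transfer_pow_apply_univ]
    exact sum_congr rfl fun f _ => chainWeight_strictWeight r f
  -- With M the weak operator, `Q` interpolates n ↦ L^n M^q. As LM = 1, this is L^(n-q) for n ≥ q,
  -- so `Q` is `P` shifted by q; at n = 0 it gives P(-q) = M^q.
  · obtain ⟨Q, hQ⟩ := exists_polynomial_eval_eq_transfer_pow (strictWeight K r) hw
      ((transfer (weakWeight K r) ^ q) (Pi.single ∅ 1)) univ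
    have hPQ : Q = P.comp (X - C (q : K)) := by
      refine polynomial_eq_of_eval_natCast_eq q fun n hn => ?_
      obtain ⟨k, rfl⟩ := Nat.exists_eq_add_of_le' hn
      have : (((k + q : ℕ) : K) - q) = (k : K) := by push_cast; ring
      rw [hQ, eval_comp, eval_sub, eval_X, eval_C, this, hP, pow_add, Module.End.mul_apply,
        ← Module.End.mul_apply (transfer (strictWeight K r) ^ q),
        pow_mul_pow_eq_one q (transfer_strictWeight_mul_weakWeight hr), Module.End.one_apply]
    have h0 := hQ 0
    rw [hPQ, eval_comp, pow_zero, Module.End.one_apply, transfer_pow_apply_univ] at h0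
    simp only [eval_sub, eval_X, eval_C, Nat.cast_zero, zero_sub] at h0
    rw [h0, mul_sum]
    exact sum_congr rfl fun f _ => chainWeight_weakWeight r f

end OrderReciprocity

/-! ### Directed cycles in forests -/

theorem SimpleGraph.exists_isPath_of_reflTransGen {V : Type*} (G : SimpleGraph V)
    {r : V → V → Prop} (hr : ∀ u v, r u v → G.Adj u v) {u v : V}
    (h : Relation.ReflTransGen r u v) :
    ∃ p : G.Walk u v, p.IsPath ∧ ∀ d ∈ p.darts, r d.fst d.snd := by
  classical
  induction h using Relation.ReflTransGen.head_induction_on with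
  | refl => exact ⟨.nil, by simp, by simp⟩
  | @head a c hac _ ih =>
    obtain ⟨p, hp, hd⟩ := ih
    -- If the path already visits `a`, it is cut there instead of being extended.
    by_cases ha : a ∈ p.support
    · exact ⟨p.dropUntil a ha, hp.dropUntil ha, fun d hdd =>
        hd d (p.darts_dropUntil_subset_darts ha hdd)⟩
    · refine ⟨.cons (hr a c hac) p, hp.cons ha, ?_⟩
      intro d hdd
      rw [SimpleGraph.Walk.darts_cons, List.mem_cons] at hdd
      rcases hdd with rfl | hdd
      · exact hac
      · exact hd d hdd

/-- An asymmetric relation on the edges of an acyclic graph has no directed cycle. -/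
theorem SimpleGraph.IsAcyclic.not_transGen {V : Type*} {G : SimpleGraph V} (hG : G.IsAcyclic)
    {r : V → V → Prop} (hr : ∀ u v, r u v → G.Adj u v) (hasymm : ∀ u v, r u v → ¬ r v u)
    (v : V) : ¬ Relation.TransGen r v v := by
  intro h
  obtain ⟨u, hvu, huv⟩ := Relation.TransGen.head'_iff.1 h
  obtain ⟨p, hp, hd⟩ := G.exists_isPath_of_reflTransGen hr huv
  have hadj : G.Adj u v := (hr v u hvu).symm
  have hq : (SimpleGraph.Walk.cons hadj .nil).IsPath := by simp [hadj.ne]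
  -- Paths in a forest are unique, so the way back from `u` to `v` is the edge itself, traversed
  -- against `r v u`.
  have := (hG.subsingleton_path u v).elim ⟨p, hp⟩ ⟨_, hq⟩
  have hpq : p = .cons hadj .nil := congrArg Subtype.val this
  subst hpq
  exact hasymm v u hvu (hd ⟨(u, v), hadj⟩ (by simp))

/-! ### Expansion over orientations and reciprocity for the B-polynomial -/

namespace MultiDigraph

variable {V A K : Type*}

/-- The relation formed by the arcs `a` with `s a = 1`, and the reversals of the arcs `a` with
`s a = 2`. -/
def orientation (D : MultiDigraph V A) (s : A → Fin 3) (u v : V) : Prop :=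
  ∃ a, (s a = 1 ∧ D.origin a = u ∧ D.target a = v) ∨ (s a = 2 ∧ D.target a = u ∧ D.origin a = v)

theorem UnderlyingIsForest.not_transGen_orientation {D : MultiDigraph V A}
    (hD : D.UnderlyingIsForest) (s : A → Fin 3) (v : V) :
    ¬ Relation.TransGen (D.orientation s) v v := by
  refine hD.no_cycle.not_transGen ?_ ?_ v
  · rintro u w ⟨a, ⟨-, rfl, rfl⟩ | ⟨-, rfl, rfl⟩⟩
    · exact (SimpleGraph.fromEdgeSet_adj _).2 ⟨⟨a, rfl⟩, hD.no_loop a⟩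
    · exact (SimpleGraph.fromEdgeSet_adj _).2 ⟨⟨a, Sym2.eq_swap⟩, (hD.no_loop a).symm⟩
  · rintro u w ⟨a, ha⟩ ⟨b, hb⟩
    -- Opposite relations must come from one arc, since there are no parallel ones; but `s` gives
    -- that arc a single direction.
    have hab : a = b := by
      refine hD.no_parallel ?_
      unfold edge
      rw [Sym2.eq_iff]
      rcases ha with ⟨-, rfl, rfl⟩ | ⟨-, rfl, rfl⟩ <;> rcases hb with ⟨-, h1, h2⟩ | ⟨-, h1, h2⟩ <;>
        simp [h1, h2]
    subst hab
    have hl := hD.no_loop a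
    rcases ha with ⟨h, h1, h2⟩ | ⟨h, h1, h2⟩ <;> rcases hb with ⟨h', h3, h4⟩ | ⟨h', h3, h4⟩
    · exact hl (h3.trans h2.symm)
    · simp [h] at h'
    · simp [h] at h'
    · exact hl (h2.trans h3.symm)

theorem IsAcyclic.not_transGen_orientation {D : MultiDigraph V A} (hD : D.IsAcyclic)
    {s : A → Fin 3} (hs : ∀ a, s a ≠ 2) (v : V) :
    ¬ Relation.TransGen (D.orientation s) v v := by
  intro h
  refine hD v (Relation.TransGen.mono (fun u w => ?_) v v h)
  rintro ⟨a, ⟨-, h⟩ | ⟨h, -⟩⟩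
  · exact ⟨a, h⟩
  · exact absurd h (hs a)

/-- The weight of a coloring: each ascent counts `y`, each descent `z`, and each arc with endpoints
of the same color `t`. -/
def weight [Fintype A] [Field K] (D : MultiDigraph V A) (y z t : K) {q : ℕ} (f : V → Fin q) : K :=
  ∏ a, if f (D.origin a) < f (D.target a) then y
    else if f (D.target a) < f (D.origin a) then z else t

theorem pow_numAscents_mul_pow_numDescents [Fintype A] [Field K] (D : MultiDigraph V A) (y z : K)
    {q : ℕ} (f : V → Fin q) : y ^ D.numAscents f * z ^ D.numDescents f = D.weight y z 1 f := by
  simp only [weight, numAscents, numDescents, ← prod_const, prod_filter]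
  rw [← prod_mul_distrib]
  refine prod_congr rfl fun a _ => ?_
  rcases lt_trichotomy (f (D.origin a)) (f (D.target a)) with h | h | h
  · simp [h, h.not_gt]
  · simp [h]
  · simp [h, h.not_gt]

variable [Fintype V] [DecidableEq V] [Fintype A] [Field K] [CharZero K]

/-- The `B`-polynomial at fixed `y` and `z`, as a polynomial in `q`. -/
noncomputable def bPolyAt (D : MultiDigraph V A) (y z : K) : K[X] :=
  MvPolynomial.aeval ![X, C y, C z] D.bPoly

theorem eval_bPolyAt (D : MultiDigraph V A) (q y z : K) :
    (D.bPolyAt y z).eval q = D.B q y z := by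
  unfold bPolyAt B
  have h := MvPolynomial.comp_aeval_apply (R := ℚ) ![X, C y, C z]
    ((Polynomial.aeval q : K[X] →ₐ[K] K).restrictScalars ℚ) D.bPoly
  simp only [AlgHom.restrictScalars_apply, coe_aeval_eq_eval] at h
  rw [h]
  congr 2
  funext i
  fin_cases i <;> simp

theorem B_natCast (D : MultiDigraph V A) {q : ℕ} (hq : 1 ≤ q) (y z : K) :
    D.B (q : K) y z = ∑ f : V → Fin q, D.weight y z 1 f := by
  have h := congrArg (MvPolynomial.aeval ![(q : K), y, z]) (D.bPoly_spec q hq)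
  rw [MvPolynomial.aeval_bind₁] at h
  simp only [map_sum, map_mul, map_pow, MvPolynomial.aeval_X] at h
  simp only [← pow_numAscents_mul_pow_numDescents]
  refine Eq.trans ?_ h
  unfold B
  congr 2
  funext i
  fin_cases i <;> simp

omit [DecidableEq V] [CharZero K] in
open Classical in
theorem weight_one_eq_sum (D : MultiDigraph V A) (y z : K) {q : ℕ} (f : V → Fin q) :
    D.weight y z 1 f = ∑ s : A → Fin 3, (∏ a, ![1, y - 1, z - 1] (s a)) *
      if ∀ u v, D.orientation s u v → f u < f v then 1 else 0 := by
  have hw : D.weight y z 1 f = ∏ a, ∑ i : Fin 3, ![1, y - 1, z - 1] i *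
      if (i = 1 → f (D.origin a) < f (D.target a)) ∧ (i = 2 → f (D.target a) < f (D.origin a))
        then 1 else 0 := by
    refine prod_congr rfl fun a _ => ?_
    rcases lt_trichotomy (f (D.origin a)) (f (D.target a)) with h | h | h <;>
      simp [Fin.sum_univ_three, h, h.not_gt]
  rw [hw, prod_univ_sum, Fintype.piFinset_univ]
  refine sum_congr rfl fun s _ => ?_
  rw [prod_mul_distrib, prod_boole]
  congr 2
  rw [eq_iff_iff]
  constructor
  · rintro h u v ⟨a, ⟨hs, rfl, rfl⟩ | ⟨hs, rfl, rfl⟩⟩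
    · exact (h a (mem_univ a)).1 hs
    · exact (h a (mem_univ a)).2 hs
  · exact fun h a _ => ⟨fun hs => h _ _ ⟨a, .inl ⟨hs, rfl, rfl⟩⟩,
      fun hs => h _ _ ⟨a, .inr ⟨hs, rfl, rfl⟩⟩⟩

-- On a tie both weak inequalities hold, so all three terms survive and add up to y+z-1.
omit [DecidableEq V] [CharZero K] in
open Classical in
theorem weight_add_sub_one_eq_sum (D : MultiDigraph V A) (y z : K) {q : ℕ} (f : V → Fin q) :
    D.weight y z (y + z - 1) f = ∑ s : A → Fin 3, (∏ a, ![1, y - 1, z - 1] (s a)) *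
      if ∀ u v, D.orientation s u v → f u ≤ f v then 1 else 0 := by
  have hw : D.weight y z (y + z - 1) f = ∏ a, ∑ i : Fin 3, ![1, y - 1, z - 1] i *
      if (i = 1 → f (D.origin a) ≤ f (D.target a)) ∧ (i = 2 → f (D.target a) ≤ f (D.origin a))
        then 1 else 0 := by
    refine prod_congr rfl fun a _ => ?_
    rcases lt_trichotomy (f (D.origin a)) (f (D.target a)) with h | h | h
    · simp [Fin.sum_univ_three, h, h.le, h.not_ge]
    · simp [Fin.sum_univ_three, h]
      ring
    · simp [Fin.sum_univ_three, h, h.le, h.not_ge, h.not_gt]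
  rw [hw, prod_univ_sum, Fintype.piFinset_univ]
  refine sum_congr rfl fun s _ => ?_
  rw [prod_mul_distrib, prod_boole]
  congr 2
  rw [eq_iff_iff]
  constructor
  · rintro h u v ⟨a, ⟨hs, rfl, rfl⟩ | ⟨hs, rfl, rfl⟩⟩
    · exact (h a (mem_univ a)).1 hs
    · exact (h a (mem_univ a)).2 hs
  · exact fun h a _ => ⟨fun hs => h _ _ ⟨a, .inl ⟨hs, rfl, rfl⟩⟩,
      fun hs => h _ _ ⟨a, .inr ⟨hs, rfl, rfl⟩⟩⟩

/-- Reciprocity for the `B`-polynomial when every orientation that contributes to the expansion of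
the weights is acyclic. -/
theorem B_neg_natCast (D : MultiDigraph V A) (y z : K)
    (h : ∀ s : A → Fin 3, ∏ a, ![1, y - 1, z - 1] (s a) ≠ 0 →
      ∀ v, ¬ Relation.TransGen (D.orientation s) v v) (q : ℕ) :
    D.B (-(q : K)) y z =
      (-1) ^ Fintype.card V * ∑ f : V → Fin q, D.weight y z (y + z - 1) f := by
  classical
  have hP : ∀ s : A → Fin 3, ∃ P : K[X], ∏ a, ![1, y - 1, z - 1] (s a) ≠ 0 → ∀ q : ℕ,
      P.eval (q : K) =
        (∑ f : V → Fin q, if ∀ u v, D.orientation s u v → f u < f v then 1 else 0) ∧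
      P.eval (-(q : K)) = (-1) ^ Fintype.card V *
        ∑ f : V → Fin q, if ∀ u v, D.orientation s u v → f u ≤ f v then 1 else 0 := by
    intro s
    by_cases hs : ∏ a, ![1, y - 1, z - 1] (s a) ≠ 0
    · obtain ⟨P, hP⟩ := exists_orderPolynomial (K := K) (h s hs)
      exact ⟨P, fun _ => hP⟩
    -- Any polynomial will do here: its coefficient is zero.
    · exact ⟨0, fun h => absurd h hs⟩
  choose P hP using hP
  have hB : D.bPolyAt y z = ∑ s : A → Fin 3, C (∏ a, ![1, y - 1, z - 1] (s a)) * P s := by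
    -- The bound is 1 because the defining property covers positive `q` only.
    refine polynomial_eq_of_eval_natCast_eq 1 fun n hn => ?_
    rw [eval_bPolyAt, B_natCast D hn, eval_finsetSum]
    simp only [weight_one_eq_sum]
    rw [sum_comm]
    refine sum_congr rfl fun s _ => ?_
    rw [eval_mul, eval_C, ← mul_sum]
    by_cases hs : ∏ a, ![1, y - 1, z - 1] (s a) = 0
    · rw [hs, zero_mul, zero_mul]
    · rw [(hP s hs n).1]
  rw [← eval_bPolyAt, hB, eval_finsetSum]
  simp only [weight_add_sub_one_eq_sum]
  rw [sum_comm, mul_sum]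
  refine sum_congr rfl fun s _ => ?_
  rw [eval_mul, eval_C, ← mul_sum]
  by_cases hs : ∏ a, ![1, y - 1, z - 1] (s a) = 0
  · rw [hs, zero_mul, zero_mul, mul_zero]
  · rw [(hP s hs q).2]
    ring

/-- An identity between values at `-q` and `q` holds for all `q` if it holds for positive
integers. -/
theorem B_neg_eq_of_natCast (D : MultiDigraph V A) (y z y' z' c : K)
    (h : ∀ q : ℕ, 1 ≤ q → D.B (-(q : K)) y z = c * D.B (q : K) y' z') (q : K) :
    D.B (-q) y z = c * D.B q y' z' := by
  have hpoly : (D.bPolyAt y z).comp (-X) = C c * D.bPolyAt y' z' := by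
    refine polynomial_eq_of_eval_natCast_eq 1 fun n hn => ?_
    simpa [eval_comp, eval_bPolyAt] using h n hn
  simpa [eval_comp, eval_bPolyAt] using congrArg (eval q) hpoly

omit [DecidableEq V] [CharZero K] [Fintype V] in
theorem weight_div (D : MultiDigraph V A) (y z : K) {t : K} (ht : t ≠ 0) {q : ℕ}
    (f : V → Fin q) :
    D.weight y z t f = t ^ Fintype.card A * D.weight (y / t) (z / t) 1 f := by
  unfold weight
  rw [← card_univ, ← prod_const, ← prod_mul_distrib]
  refine prod_congr rfl fun a _ => ?_
  split_ifs <;> field_simp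

omit [DecidableEq V] [CharZero K] [Fintype V] in
theorem weight_rev (D : MultiDigraph V A) (y z t : K) {q : ℕ} (f : V → Fin q) :
    D.weight y z t (fun v => (f v).rev) = D.weight z y t f := by
  refine prod_congr rfl fun a _ => ?_
  simp only [Fin.rev_lt_rev]
  rcases lt_trichotomy (f (D.origin a)) (f (D.target a)) with h | h | h <;> simp [h, h.not_gt]

-- Reversing the order of the colors exchanges ascents and descents.
omit [CharZero K] in
theorem sum_weight_swap (D : MultiDigraph V A) (y z t : K) (q : ℕ) :
    ∑ f : V → Fin q, D.weight y z t f = ∑ f : V → Fin q, D.weight z y t f := by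
  rw [← (Equiv.piCongrRight fun _ : V => Fin.revPerm (n := q)).sum_comp]
  exact sum_congr rfl fun f _ => D.weight_rev y z t f

end MultiDigraph

theorem theorem6p9 {V A : Type*} [Fintype V] [DecidableEq V] [Fintype A] (D : MultiDigraph V A)
    {K : Type*} [Field K] [CharZero K] :
    (D.IsAcyclic →
      ∀ q y : K, y ≠ 0 →
        D.B (-q) y 1 = (-1) ^ Fintype.card V * y ^ Fintype.card A * D.B q (1 / y) 1) ∧
    (D.UnderlyingIsForest →
      ∀ q y z : K, y + z - 1 ≠ 0 →
        D.B (-q) y z = (-1) ^ Fintype.card V * (y + z - 1) ^ Fintype.card A *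
          D.B q (y / (y + z - 1)) (z / (y + z - 1))) := by
  constructor
  · intro hD q y hy
    refine D.B_neg_eq_of_natCast _ _ _ _ _ (fun n hn => ?_) q
    -- For z = 1 the tie weight is y, and division by y turns the weights (y, 1, y) into (1, 1/y,
    -- 1); the swap matches this with (1/y, 1, 1).
    rw [D.B_neg_natCast, D.B_natCast hn, mul_assoc, add_sub_cancel_right,
      D.sum_weight_swap (1 / y), Finset.mul_sum (a := y ^ Fintype.card A)]
    · congr 1
      refine Finset.sum_congr rfl fun f _ => ?_
      rw [D.weight_div _ _ hy, div_self hy]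
    · intro s hs
      -- A reversed arc contributes the factor z - 1 = 0.
      refine hD.not_transGen_orientation fun a ha => hs ?_
      exact Finset.prod_eq_zero (Finset.mem_univ a) (by simp [ha])
  · intro hD q y z ht
    refine D.B_neg_eq_of_natCast _ _ _ _ _ (fun n hn => ?_) q
    rw [D.B_neg_natCast, D.B_natCast hn, mul_assoc,
      Finset.mul_sum (a := (y + z - 1) ^ Fintype.card A)]
    · congr 1
      exact Finset.sum_congr rfl fun f _ => D.weight_div _ _ ht f
    · exact fun s _ => hD.not_transGen_orientation s
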